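/- For $n\ge 2$ let $A_n$ be the alternating group on $\{1,\dots,n\}$, let $U_{A_n}$ be the uniform distribution on $A_n$, and let $P=P_n$ be the probability measure on $A_n$ that gives mass $\frac{1}{2n-3}$ to each of the identity, the $3$-cycles $(i,n-1,n)$ and the $3$-cycles $(i,n,n-1)$, $1\le i\le n-2$ (the transpose top-$2$ with random shuffle). Let $P^{*k}$ be the $k$-fold convolution of $P$ with itself, where $(p*q)(x)=\sum_{y\in A_n}p(xy^{-1})q(y)$ and $P^{*0}$ is the point mass at the identity, and let $\|\mu-\nu\|_{\mathrm{TV}}=\sup_{A\subseteq A_n}|\mu(A)-\nu(A)|$. 1. There are a sequence of real numbers $\delta_n\to 0$ (as $n\to\infty$) and an integer $N$ such that for all $n\ge N$, all real $c<0$ and all integers $k\ge 0$ with $k=(n-\frac32)(\log n+c)$, $$\|P^{*k}-U_{A_n}\|_{\mathrm{TV}}\;\ge\;1-\frac{6}{1+e^{-c}(1+\delta_n)} .$$ 2. For every $\epsilon\in(0,1)$, with $k_n=\lfloor(1-\epsilon)(n-\frac32)\log n\rfloor$, $$\lim_{n\to\infty}\|P^{*k_n}-U_{A_n}\|_{\mathrm{TV}}=1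 .$$ -/

import Mathlib

/-- The convolution `(p * q)(x) = ∑ y, p (x y⁻¹) q y` of two mass functions on a finite group. -/
noncomputable def conv {G : Type*} [Group G] [Fintype G] (p q : G → ℝ) : G → ℝ :=
  fun x => ∑ y : G, p (x * y⁻¹) * q y

/-- The `k`-fold convolution of `p` with itself: the law after `k` steps of the random walk driven
by `p` and started at the identity. The `0`-fold convolution is the point mass at the identity. -/
noncomputable def convPow {G : Type*} [Group G] [Fintype G] [DecidableEq G]
    (p : G → ℝ) : ℕ → G → ℝ
  | 0 => fun x => if x = 1 then 1 else 0
  | k + 1 => conv (convPow p k) p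

/-- The uniform distribution on a finite group. -/
noncomputable def uniformDist (G : Type*) [Fintype G] : G → ℝ :=
  fun _ => 1 / (Fintype.card G : ℝ)

/-- The total variation distance `sup_A |μ(A) - ν(A)|` of two mass functions on a finite set. -/
noncomputable def tvDist {Ω : Type*} [Fintype Ω] (μ ν : Ω → ℝ) : ℝ :=
  ⨆ A : Finset Ω, |∑ x ∈ A, μ x - ∑ x ∈ A, ν x|

/-- The increments of the transpose top-2 with random shuffle, for the cards `0, …, n - 1`:
the identity and the 3-cycles `(i, a, b)` and `(i, b, a)`, where `a = n - 2` and `b = n - 1` are the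
last two cards and `i < n - 2`. (`List.formPerm [x, y, z]` is the cycle `x ↦ y ↦ z ↦ x`.) -/
def topTwoIncrements (n : ℕ) : Set (alternatingGroup (Fin n)) :=
  {π | π = 1 ∨ ∃ i a b : Fin n, i.val < n - 2 ∧ a.val = n - 2 ∧ b.val = n - 1 ∧
    ((π : Equiv.Perm (Fin n)) = List.formPerm [i, a, b] ∨
      (π : Equiv.Perm (Fin n)) = List.formPerm [i, b, a])}

/-- The law of one step of the transpose top-2 with random shuffle on `A_n`: mass `1 / (2n - 3)` on
each of the `2n - 3` increments (a probability for `n ≥ 2`). -/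
noncomputable def topTwoShuffle (n : ℕ) : alternatingGroup (Fin n) → ℝ :=
  (topTwoIncrements n).indicator (fun _ => 1 / (2 * (n : ℝ) - 3))

/-- The total variation distance between the law of the shuffle after `k` steps and the uniform
distribution on `A_n`. -/
noncomputable def shuffleTV (n k : ℕ) : ℝ :=
  tvDist (convPow (topTwoShuffle n) k) (uniformDist (alternatingGroup (Fin n)))

/-!
Call a card among the first `n - 2` untouched if none of the first `k` increments moves it. A single
increment leaves a given such card in place with probability `1 - 2 / (2n - 3)`, so the number of
untouched cards has mean `μ = (n - 2) (1 - 2 / (2n - 3)) ^ k`. No increment moves two of the first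
`n - 2` cards, so the events that two distinct cards are untouched are negatively correlated, and
the variance of the number of untouched cards is at most `μ`. Untouched cards are fixed points of
the product, whereas the number of fixed points of a uniform element of the `2`-transitive group
`A_n` has mean `1` and variance at most `1`, by Burnside's lemma on cards and on pairs of cards.
Cantelli's inequality on both sides of the threshold `μ / 2` shows that the two laws are at distance
at least `1 - 4 / (4 + μ) - 1 / (1 + (μ / 2 - 1) ^ 2) ≥ 1 - 6 / (1 + μ)` if `5 ≤ μ`, and for smaller
`μ` the last bound is trivial. Finally `μ ≥ exp (-c) (1 + o(1))` when
`k = (n - 3 / 2) (log n + c)`.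
-/

open Finset Filter Topology

section TotalVariation

variable {Ω : Type*} [Fintype Ω]

lemma abs_sum_sub_sum_le_tvDist (μ ν : Ω → ℝ) (A : Finset Ω) :
    |∑ x ∈ A, μ x - ∑ x ∈ A, ν x| ≤ tvDist μ ν :=
  le_ciSup (f := fun A : Finset Ω => |∑ x ∈ A, μ x - ∑ x ∈ A, ν x|)
    (Set.finite_range _).bddAbove A

lemma tvDist_nonneg (μ ν : Ω → ℝ) : 0 ≤ tvDist μ ν := by
  simpa using abs_sum_sub_sum_le_tvDist μ ν ∅

lemma sum_mem_Icc_of_mem_stdSimplex {μ : Ω → ℝ} (hμ : μ ∈ stdSimplex ℝ Ω) (A : Finset Ω) :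
    ∑ x ∈ A, μ x ∈ Set.Icc 0 1 :=
  ⟨sum_nonneg fun x _ => hμ.1 x, hμ.2 ▸ sum_le_univ_sum_of_nonneg hμ.1⟩

lemma tvDist_le_one {μ ν : Ω → ℝ} (hμ : μ ∈ stdSimplex ℝ Ω) (hν : ν ∈ stdSimplex ℝ Ω) :
    tvDist μ ν ≤ 1 :=
  ciSup_le fun A =>
    have ⟨hμ0, hμ1⟩ := sum_mem_Icc_of_mem_stdSimplex hμ A
    have ⟨hν0, hν1⟩ := sum_mem_Icc_of_mem_stdSimplex hν A
    abs_sub_le_of_nonneg_of_le hμ0 hμ1 hν0 hν1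

lemma one_sub_sum_lower_sub_sum_upper_le_tvDist {μ ν : Ω → ℝ} (hμ : ∑ x, μ x = 1)
    (hν : ∀ x, 0 ≤ ν x) (X : Ω → ℝ) (r : ℝ) :
    1 - ∑ x with X x ≤ r, μ x - ∑ x with r ≤ X x, ν x ≤ tvDist μ ν := by
  have hsplit := sum_filter_add_sum_filter_not univ (fun x => X x ≤ r) μ
  have hupper : ∑ x with ¬X x ≤ r, ν x ≤ ∑ x with r ≤ X x, ν x :=
    sum_le_sum_of_subset_of_nonneg
      (monotone_filter_right univ fun _ _ hx => (not_le.1 hx).le) fun x _ _ => hν x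
  have htv := (le_abs_self _).trans (abs_sum_sub_sum_le_tvDist μ ν {x | ¬X x ≤ r})
  linarith

end TotalVariation

section Moments

variable {Ω : Type*} [Fintype Ω]

/-- The expectation of `X` when the point `x` has probability `W x`; there is no normalisation by
the total weight. -/
def massMean (W X : Ω → ℝ) : ℝ := ∑ x, W x * X x

/-- The variance of `X` when the point `x` has probability `W x`. -/
def massVariance (W X : Ω → ℝ) : ℝ := massMean W fun x => (X x - massMean W X) ^ 2

variable {W : Ω → ℝ}

lemma massMean_neg (W X : Ω → ℝ) : massMean W (-X) = -massMean W X := by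
  simp [massMean]

lemma massVariance_neg (W X : Ω → ℝ) : massVariance W (-X) = massVariance W X := by
  simp only [massVariance, massMean_neg, Pi.neg_apply, ← neg_sub', neg_sq]

lemma massVariance_nonneg (hW : ∀ x, 0 ≤ W x) (X : Ω → ℝ) : 0 ≤ massVariance W X :=
  sum_nonneg fun x _ => mul_nonneg (hW x) (sq_nonneg _)

lemma massMean_sub_sq (hW : ∑ x, W x = 1) (X : Ω → ℝ) (a : ℝ) :
    massMean W (fun x => (X x - a) ^ 2) = massVariance W X + (massMean W X - a) ^ 2 := by
  have hexpand (b : ℝ) : massMean W (fun x => (X x - b) ^ 2) =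
      massMean W (fun x => X x ^ 2) - 2 * b * massMean W X + b ^ 2 := by
    rw [← mul_one (b ^ 2), ← hW]
    simp only [massMean, mul_sum, ← sum_sub_distrib, ← sum_add_distrib]
    exact sum_congr rfl fun x _ => by ring
  rw [massVariance, hexpand, hexpand]
  ring

lemma massVariance_eq_sub (hW : ∑ x, W x = 1) (X : Ω → ℝ) :
    massVariance W X = massMean W (fun x => X x ^ 2) - massMean W X ^ 2 := by
  have h := massMean_sub_sq hW X 0
  simp only [sub_zero] at h
  linarith

lemma sum_filter_le_mul_sq_le_massMean_sq (hW : ∀ x, 0 ≤ W x) (X : Ω → ℝ) {d : ℝ} (hd : 0 ≤ d) :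
    (∑ x with d ≤ X x, W x) * d ^ 2 ≤ massMean W fun x => X x ^ 2 := by
  rw [sum_mul]
  calc ∑ x with d ≤ X x, W x * d ^ 2
      ≤ ∑ x with d ≤ X x, W x * X x ^ 2 := sum_le_sum fun x hx =>
        mul_le_mul_of_nonneg_left (pow_le_pow_left₀ hd (mem_filter.1 hx).2 2) (hW x)
    _ ≤ ∑ x, W x * X x ^ 2 :=
        sum_le_univ_sum_of_nonneg fun x => mul_nonneg (hW x) (sq_nonneg _)

-- Cantelli's inequality; the shift `v / t` is the one that optimises Markov's inequality.
lemma sum_filter_massMean_add_le_le_div (hW : W ∈ stdSimplex ℝ Ω) {X : Ω → ℝ} {v t : ℝ}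
    (hv : massVariance W X ≤ v) (ht : 0 < t) :
    ∑ x with massMean W X + t ≤ X x, W x ≤ v / (v + t ^ 2) := by
  have hv0 : 0 ≤ v := (massVariance_nonneg hW.1 X).trans hv
  have hmarkov : (∑ x with massMean W X + t ≤ X x, W x) * (t + v / t) ^ 2 ≤ v + (v / t) ^ 2 := by
    have h := sum_filter_le_mul_sq_le_massMean_sq hW.1 (fun x => X x - (massMean W X - v / t))
      (d := t + v / t) (by positivity)
    rw [massMean_sub_sq hW.2, sub_sub_cancel] at h
    simp only [show ∀ x, t + v / t ≤ X x - (massMean W X - v / t) ↔ massMean W X + t ≤ X x from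
      fun x => by constructor <;> intro <;> linarith] at h
    linarith
  calc ∑ x with massMean W X + t ≤ X x, W x
      ≤ (v + (v / t) ^ 2) / (t + v / t) ^ 2 := (le_div_iff₀ (by positivity)).2 hmarkov
    _ = v / (v + t ^ 2) := by field_simp; ring

lemma sum_filter_le_massMean_sub_le_div (hW : W ∈ stdSimplex ℝ Ω) {X : Ω → ℝ} {v t : ℝ}
    (hv : massVariance W X ≤ v) (ht : 0 < t) :
    ∑ x with X x ≤ massMean W X - t, W x ≤ v / (v + t ^ 2) := by
  have h := sum_filter_massMean_add_le_le_div hW ((massVariance_neg W X).trans_le hv) ht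
  simpa only [massMean_neg, Pi.neg_apply, neg_add_eq_sub, ← neg_sub _ t, neg_le_neg_iff] using h

end Moments

section IndependentSamples

variable {H : Type*} {p : H → ℝ} {k : ℕ}

/-- The law of `k` independent samples from the mass function `p`. -/
def iidMass (p : H → ℝ) (k : ℕ) (w : Fin k → H) : ℝ := ∏ j, p (w j)

variable [Fintype H]

lemma iidMass_mem_stdSimplex (hp : p ∈ stdSimplex ℝ H) (k : ℕ) :
    iidMass p k ∈ stdSimplex ℝ (Fin k → H) :=
  ⟨fun w => prod_nonneg fun j _ => hp.1 (w j), by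
    simp only [iidMass, ← Fintype.sum_pow, hp.2, one_pow]⟩

lemma sum_iidMass_filter_forall (p : H → ℝ) (k : ℕ) (E : H → Prop) [DecidablePred E] :
    ∑ w : Fin k → H with ∀ j, E (w j), iidMass p k w = (∑ y with E y, p y) ^ k := by
  rw [sum_pow']
  refine sum_congr ?_ fun _ _ => rfl
  ext w
  simp

variable {ι : Type*} (s : Finset ι) (E : ι → H → Prop) [∀ i, DecidablePred (E i)]

/-- The number of events `E i`, `i ∈ s`, that occur at every one of the `k` samples `w`. -/
def persistCount (w : Fin k → H) : ℕ := #{i ∈ s | ∀ j, E i (w j)}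

lemma massMean_persistCount (p : H → ℝ) (k : ℕ) :
    massMean (iidMass p k) (fun w => (persistCount s E w : ℝ)) =
      ∑ i ∈ s, (∑ y with E i y, p y) ^ k := by
  simp only [← sum_iidMass_filter_forall]
  simp only [massMean, persistCount, natCast_card_filter, mul_sum,
    sum_filter, mul_ite, mul_one, mul_zero]
  exact sum_comm

lemma massMean_persistCount_sq (p : H → ℝ) (k : ℕ) :
    massMean (iidMass p k) (fun w => (persistCount s E w : ℝ) ^ 2) =
      ∑ i ∈ s, ∑ i' ∈ s, (∑ y with E i y ∧ E i' y, p y) ^ k := by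
  have hsq (w : Fin k → H) : (persistCount s E w : ℝ) ^ 2 =
      ∑ i ∈ s, ∑ i' ∈ s, if ∀ j, E i (w j) ∧ E i' (w j) then 1 else 0 := by
    simp only [persistCount, natCast_card_filter, sq, sum_mul_sum, mul_ite, mul_one,
      mul_zero, ← ite_and, forall_and, and_comm]
  simp only [← sum_iidMass_filter_forall]
  simp only [massMean, hsq, mul_sum, sum_filter, mul_ite, mul_one, mul_zero]
  rw [sum_comm]
  exact sum_congr rfl fun i _ => sum_comm

lemma massVariance_persistCount_le (hp : p ∈ stdSimplex ℝ H)
    (hE : (s : Set ι).Pairwise fun i i' =>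
      ∑ y with E i y ∧ E i' y, p y ≤ (∑ y with E i y, p y) * ∑ y with E i' y, p y) (k : ℕ) :
    massVariance (iidMass p k) (fun w => (persistCount s E w : ℝ)) ≤
      ∑ i ∈ s, (∑ y with E i y, p y) ^ k := by
  classical
  rw [massVariance_eq_sub (iidMass_mem_stdSimplex hp k).2, massMean_persistCount,
    massMean_persistCount_sq, sub_le_iff_le_add]
  set q : ι → ℝ := fun i => (∑ y with E i y, p y) ^ k
  have hnonneg (F : H → Prop) [DecidablePred F] : 0 ≤ ∑ y with F y, p y :=
    (sum_mem_Icc_of_mem_stdSimplex hp _).1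
  have hpair : ∀ i ∈ s, ∀ i' ∈ s, (∑ y with E i y ∧ E i' y, p y) ^ k ≤
      (if i = i' then q i else 0) + q i * q i' := fun i hi i' hi' => by
    split_ifs with h
    · subst h
      simpa only [and_self, q, le_add_iff_nonneg_right] using mul_self_nonneg (q i)
    · rw [zero_add, ← mul_pow]
      exact pow_le_pow_left₀ (hnonneg _) (hE hi hi' h) k
  calc ∑ i ∈ s, ∑ i' ∈ s, (∑ y with E i y ∧ E i' y, p y) ^ k
      ≤ ∑ i ∈ s, ∑ i' ∈ s, ((if i = i' then q i else 0) + q i * q i') :=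
        sum_le_sum fun i hi => sum_le_sum (hpair i hi)
    _ = ∑ i ∈ s, q i + (∑ i ∈ s, q i) ^ 2 := by
        simp [sum_add_distrib, sq, sum_mul_sum]

end IndependentSamples

section Convolution

variable {G : Type*} [Group G] [Fintype G] [DecidableEq G] {p : G → ℝ}

lemma convPow_eq_sum_iidMass (p : G → ℝ) (k : ℕ) (x : G) :
    convPow p k x = ∑ w : Fin k → G with (List.ofFn w).prod = x, iidMass p k w := by
  induction k generalizing x with
  | zero => by_cases h : 1 = x <;> simp [convPow, iidMass, eq_comm (a := x), h]
  | succ k ih =>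
    simp only [convPow, conv, ih, sum_filter, sum_mul]
    rw [← (Fin.snocEquiv fun _ : Fin (k + 1) => G).sum_comp, Fintype.sum_prod_type]
    refine sum_congr rfl fun y _ => sum_congr rfl fun w _ => ?_
    simp [iidMass, Fin.snocEquiv, Fin.prod_univ_castSucc, List.ofFn_succ', -List.ofFn_succ,
      eq_mul_inv_iff_mul_eq]

lemma sum_convPow_filter (p : G → ℝ) (k : ℕ) (P : G → Prop) [DecidablePred P] :
    ∑ x with P x, convPow p k x =
      ∑ w : Fin k → G with P (List.ofFn w).prod, iidMass p k w := by
  simp only [convPow_eq_sum_iidMass]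
  rw [sum_comm' (t' := {w | P (List.ofFn w).prod}) (s' := fun w => {(List.ofFn w).prod})]
  · simp only [sum_singleton]
  · simp only [mem_filter_univ, mem_singleton]
    grind

lemma convPow_mem_stdSimplex (hp : p ∈ stdSimplex ℝ G) (k : ℕ) :
    convPow p k ∈ stdSimplex ℝ G := by
  have hiid := iidMass_mem_stdSimplex hp k
  refine ⟨fun x => ?_, ?_⟩
  · rw [convPow_eq_sum_iidMass]
    exact sum_nonneg fun w _ => hiid.1 w
  · simpa [hiid.2] using sum_convPow_filter p k fun _ => True

lemma uniformDist_mem_stdSimplex (Ω : Type*) [Fintype Ω] [Nonempty Ω] :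
    uniformDist Ω ∈ stdSimplex ℝ Ω :=
  ⟨fun _ => by unfold uniformDist; positivity, by simp [uniformDist]⟩

end Convolution

section TwoTransitive

open MulAction

lemma isMultiplyPretransitive_alternatingGroup_two {α : Type*} [Fintype α] [DecidableEq α]
    (hα : 4 ≤ Nat.card α) : IsMultiplyPretransitive (alternatingGroup α) α 2 :=
  have := alternatingGroup.isMultiplyPretransitive α
  isMultiplyPretransitive_of_le (n := Nat.card α - 2) (by lia) (Nat.sub_le _ _)

lemma massMean_uniformDist_ncard_fixedBy (G α : Type*) [Group G] [Fintype G] [MulAction G α]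
    [Finite α] :
    massMean (uniformDist G) (fun g => ((fixedBy α g).ncard : ℝ)) =
      Nat.card (orbitRel.Quotient G α) := by
  have hburnside :
      ∑ g : G, (fixedBy α g).ncard = Nat.card (orbitRel.Quotient G α) * Nat.card G := by
    rw [← Nat.card_prod, ← Nat.card_congr (sigmaFixedByEquivOrbitsProdGroup G α), Nat.card_sigma]
    rfl
  rw [Nat.card_eq_fintype_card (α := G)] at hburnside
  simp only [massMean, uniformDist]
  rw [← mul_sum, ← Nat.cast_sum, hburnside]
  push_cast
  field_simp

variable {G α : Type*} [Group G] [MulAction G α]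

lemma fixedBy_prod (g : G) : fixedBy (α × α) g = fixedBy α g ×ˢ fixedBy α g := by
  ext
  simp [Prod.ext_iff]

lemma card_orbitRel_quotient_prod_le_two [IsMultiplyPretransitive G α 2] :
    Nat.card (orbitRel.Quotient G (α × α)) ≤ 2 := by
  have htrans := isPretransitive_of_is_two_pretransitive (G := G) (α := α)
  let onDiagonal : orbitRel.Quotient G (α × α) → Prop :=
    Quotient.lift (fun x : α × α => x.1 = x.2) (by rintro _ _ ⟨g, rfl⟩; simp)
  have hinj : Function.Injective onDiagonal := by
    rintro ⟨a, b⟩ ⟨c, d⟩ h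
    replace h : a = b ↔ c = d := iff_of_eq h
    refine Quotient.sound' ((orbitRel_apply ..).2 ?_)
    by_cases hcd : c = d
    · obtain ⟨g, hg⟩ := exists_smul_eq G c a
      exact ⟨g, by simp [← hcd, ← h.2 hcd, hg]⟩
    · obtain ⟨g, hgc, hgd⟩ := is_two_pretransitive_iff.1 ‹_› hcd (mt h.1 hcd)
      exact ⟨g, by simp [hgc, hgd]⟩
  simpa using Nat.card_le_card_of_injective onDiagonal hinj

variable [Fintype G] [Finite α] [Nonempty α] [IsMultiplyPretransitive G α 2]

lemma massMean_uniformDist_ncard_fixedBy_eq_one :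
    massMean (uniformDist G) (fun g => ((fixedBy α g).ncard : ℝ)) = 1 := by
  have htrans := isPretransitive_of_is_two_pretransitive (G := G) (α := α)
  obtain ⟨_⟩ := (pretransitive_iff_unique_quotient_of_nonempty G α).1 htrans
  rw [massMean_uniformDist_ncard_fixedBy, Nat.card_unique, Nat.cast_one]

lemma massVariance_uniformDist_ncard_fixedBy_le_one :
    massVariance (uniformDist G) (fun g => ((fixedBy α g).ncard : ℝ)) ≤ 1 := by
  have hsq : massMean (uniformDist G) (fun g => ((fixedBy α g).ncard : ℝ) ^ 2) ≤ 2 := by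
    simp only [sq, ← Nat.cast_mul, ← Set.ncard_prod, ← fixedBy_prod,
      massMean_uniformDist_ncard_fixedBy]
    exact_mod_cast card_orbitRel_quotient_prod_le_two
  rw [massVariance_eq_sub (uniformDist_mem_stdSimplex G).2,
    massMean_uniformDist_ncard_fixedBy_eq_one]
  linarith

lemma sum_uniformDist_filter_ncard_fixedBy_le {r : ℝ} (hr : 1 < r) :
    ∑ g with r ≤ ((fixedBy α g).ncard : ℝ), uniformDist G g ≤ 1 / (1 + (r - 1) ^ 2) := by
  have h := sum_filter_massMean_add_le_le_div (uniformDist_mem_stdSimplex G)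
    (massVariance_uniformDist_ncard_fixedBy_le_one (G := G) (α := α)) (sub_pos.2 hr)
  simpa only [massMean_uniformDist_ncard_fixedBy_eq_one, add_sub_cancel] using h

end TwoTransitive

section FixedPointStatistic

open MulAction

variable {G α : Type*} [Group G] [MulAction G α] [DecidableEq α]

lemma persistCount_le_ncard_fixedBy_prod [Finite α] (s : Finset α) {k : ℕ} (w : Fin k → G) :
    persistCount s (fun a g => g • a = a) w ≤ (fixedBy α (List.ofFn w).prod).ncard := by
  rw [persistCount, ← Set.ncard_coe_finset]
  refine Set.ncard_le_ncard fun a ha => ?_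
  have hstab : ∀ g ∈ List.ofFn w, g ∈ stabilizer G a := by
    simpa [List.mem_ofFn] using (mem_filter.1 ha).2
  exact Subgroup.list_prod_mem _ hstab

/-- The probability that a random group element with mass function `p` fixes every point of `s`. -/
def fixMass [Fintype G] (p : G → ℝ) (s : Finset α) : ℝ := ∑ g with ∀ a ∈ s, g • a = a, p g

variable [Fintype G] [DecidableEq G] [Finite α] {p : G → ℝ} {s : Finset α}

-- A point fixed at every step is fixed by the product, and the number of such points has
-- variance at most its mean `μ`.
lemma sum_convPow_filter_ncard_fixedBy_le (hp : p ∈ stdSimplex ℝ G)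
    (hs : (s : Set α).Pairwise fun a b => fixMass p {a, b} ≤ fixMass p {a} * fixMass p {b})
    (k : ℕ) {μ : ℝ} (hμ : ∑ a ∈ s, fixMass p {a} ^ k = μ) (hμ0 : 0 < μ) :
    ∑ g with ((fixedBy α g).ncard : ℝ) ≤ μ / 2, convPow p k g ≤ 4 / (4 + μ) := by
  simp only [fixMass, mem_insert, mem_singleton, forall_eq_or_imp, forall_eq] at hs hμ
  have hiid := iidMass_mem_stdSimplex hp k
  set U : (Fin k → G) → ℝ := fun w => persistCount s (fun a g => g • a = a) w
  have hmean : massMean (iidMass p k) U = μ := (massMean_persistCount s _ p k).trans hμ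
  have hvar : massVariance (iidMass p k) U ≤ μ :=
    (massVariance_persistCount_le s _ hp hs k).trans_eq hμ
  calc ∑ g with ((fixedBy α g).ncard : ℝ) ≤ μ / 2, convPow p k g
      = ∑ w with ((fixedBy α (List.ofFn w).prod).ncard : ℝ) ≤ μ / 2, iidMass p k w :=
        sum_convPow_filter p k _
    _ ≤ ∑ w with U w ≤ massMean (iidMass p k) U - μ / 2, iidMass p k w := by
        rw [hmean, sub_half]
        refine sum_le_sum_of_subset_of_nonneg (fun w hw => ?_) fun w _ _ => hiid.1 w
        rw [mem_filter_univ] at hw ⊢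
        exact (Nat.cast_le.2 (persistCount_le_ncard_fixedBy_prod s w)).trans hw
    _ ≤ μ / (μ + (μ / 2) ^ 2) := sum_filter_le_massMean_sub_le_div hiid hvar (half_pos hμ0)
    _ = 4 / (4 + μ) := by field_simp; ring

theorem one_sub_six_div_le_tvDist_convPow_uniformDist [Nonempty α]
    [IsMultiplyPretransitive G α 2] (hp : p ∈ stdSimplex ℝ G)
    (hs : (s : Set α).Pairwise fun a b => fixMass p {a, b} ≤ fixMass p {a} * fixMass p {b})
    (k : ℕ) :
    1 - 6 / (1 + ∑ a ∈ s, fixMass p {a} ^ k) ≤ tvDist (convPow p k) (uniformDist G) := by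
  set μ := ∑ a ∈ s, fixMass p {a} ^ k with hμ
  have hμ0 : 0 ≤ μ := sum_nonneg fun a _ =>
    pow_nonneg (sum_mem_Icc_of_mem_stdSimplex hp _).1 k
  obtain hμ5 | hμ5 := lt_or_ge μ 5
  · refine le_trans ?_ (tvDist_nonneg _ _)
    rw [sub_nonpos, one_le_div (by positivity)]
    linarith
  have hwalk := sum_convPow_filter_ncard_fixedBy_le hp hs k hμ.symm (by linarith)
  have hunif := sum_uniformDist_filter_ncard_fixedBy_le (G := G) (α := α)
    (show 1 < μ / 2 by linarith)
  have htv := one_sub_sum_lower_sub_sum_upper_le_tvDist (convPow_mem_stdSimplex hp k).2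
    (uniformDist_mem_stdSimplex G).1 (fun g => ((fixedBy α g).ncard : ℝ)) (μ / 2)
  have hwalk' : 4 / (4 + μ) ≤ 4 / (1 + μ) := by gcongr; norm_num
  have hunif' : 1 / (1 + (μ / 2 - 1) ^ 2) ≤ 2 / (1 + μ) := by
    rw [div_le_div_iff₀ (by positivity) (by positivity)]
    nlinarith
  have hsplit : 6 / (1 + μ) = 4 / (1 + μ) + 2 / (1 + μ) := by ring
  linarith

end FixedPointStatistic

section TopTwo

variable {m : ℕ}

/-- The increments of the shuffle of `m + 2` cards in cycle notation: `none` is the identity, and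
`some (i, true)`, `some (i, false)` are the two `3`-cycles through `i` and the last two cards. -/
def topTwoCycle : Option (Fin m × Bool) → List (Fin (m + 2))
  | none => []
  | some (i, true) => [Fin.castAdd 2 i, Fin.natAdd m 0, Fin.natAdd m 1]
  | some (i, false) => [Fin.castAdd 2 i, Fin.natAdd m 1, Fin.natAdd m 0]

lemma castAdd_ne_natAdd {n : ℕ} (i : Fin m) (j : Fin n) : Fin.castAdd n i ≠ Fin.natAdd m j :=
  Fin.ne_of_val_ne (by simp only [Fin.val_castAdd, Fin.val_natAdd]; lia)

lemma formPerm_topTwoCycle_mem_alternatingGroup (x : Option (Fin m × Bool)) :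
    (topTwoCycle x).formPerm ∈ alternatingGroup (Fin (m + 2)) := by
  rcases x with _ | ⟨i, _ | _⟩ <;> simp [topTwoCycle, castAdd_ne_natAdd]

lemma formPerm_topTwoCycle_apply_castAdd_eq_iff (x : Option (Fin m × Bool)) (i : Fin m) :
    (topTwoCycle x).formPerm (Fin.castAdd 2 i) = Fin.castAdd 2 i ↔ ∀ b, x ≠ some (i, b) := by
  rcases x with _ | ⟨j, _ | _⟩
  · simp [topTwoCycle]
  all_goals
    obtain rfl | hij := eq_or_ne i j
    · simp [topTwoCycle, castAdd_ne_natAdd, (castAdd_ne_natAdd _ _).symm, Equiv.swap_apply_def]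
    · simp [topTwoCycle, castAdd_ne_natAdd, Equiv.swap_apply_def, hij, hij.symm]

/-- The increments of the shuffle of `m + 2` cards, as elements of the alternating group. -/
def topTwoIncrement (x : Option (Fin m × Bool)) : alternatingGroup (Fin (m + 2)) :=
  ⟨(topTwoCycle x).formPerm, formPerm_topTwoCycle_mem_alternatingGroup x⟩

-- An increment is determined by the new positions of the last two cards.
lemma topTwoIncrement_injective : Function.Injective (topTwoIncrement (m := m)) := by
  intro x y h
  have happly (a) : (topTwoCycle x).formPerm a = (topTwoCycle y).formPerm a :=
    Equiv.congr_fun (congrArg Subtype.val h) a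
  have ha := happly (Fin.natAdd m 0)
  have hb := happly (Fin.natAdd m 1)
  rcases x with _ | ⟨i, _ | _⟩ <;> rcases y with _ | ⟨j, _ | _⟩ <;>
    simp [topTwoCycle, castAdd_ne_natAdd, (castAdd_ne_natAdd _ _).symm,
      Equiv.swap_apply_def] at ha hb <;> simp [*]

lemma range_topTwoIncrement :
    Set.range (topTwoIncrement (m := m)) = topTwoIncrements (m + 2) := by
  ext π
  constructor
  · rintro ⟨_ | ⟨i, _ | _⟩, rfl⟩
    · exact Or.inl rfl
    · exact Or.inr ⟨_, Fin.natAdd m 0, Fin.natAdd m 1, i.2, rfl, rfl, Or.inr rfl⟩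
    · exact Or.inr ⟨_, Fin.natAdd m 0, Fin.natAdd m 1, i.2, rfl, rfl, Or.inl rfl⟩
  · rintro (rfl | ⟨i, a, b, hi, ha, hb, h⟩)
    · exact ⟨none, rfl⟩
    · obtain rfl : a = Fin.natAdd m 0 := Fin.ext ha
      obtain rfl : b = Fin.natAdd m 1 := Fin.ext hb
      obtain h | h := h
      · exact ⟨some (⟨i, hi⟩, true), Subtype.ext h.symm⟩
      · exact ⟨some (⟨i, hi⟩, false), Subtype.ext h.symm⟩

lemma topTwoShuffle_add_two :
    topTwoShuffle (m + 2) =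
      (Set.range topTwoIncrement).indicator fun _ => 1 / (2 * (m : ℝ) + 1) := by
  rw [topTwoShuffle, range_topTwoIncrement]
  push_cast
  ring_nf

lemma sum_topTwoShuffle_filter (P : alternatingGroup (Fin (m + 2)) → Prop) [DecidablePred P] :
    ∑ π with P π, topTwoShuffle (m + 2) π =
      #{x : Option (Fin m × Bool) | P (topTwoIncrement x)} / (2 * m + 1) := by
  classical
  have himage : ({π | P π} : Finset (alternatingGroup (Fin (m + 2)))).filter
      (· ∈ Set.range topTwoIncrement) =
        ({x | P (topTwoIncrement x)} : Finset _).image topTwoIncrement := by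
    ext π
    simp only [mem_filter, mem_univ, true_and, mem_image, Set.mem_range]
    grind
  simp only [topTwoShuffle_add_two, Set.indicator_apply]
  rw [← sum_filter, himage, sum_const, card_image_of_injective _ topTwoIncrement_injective,
    nsmul_eq_mul, mul_one_div]

lemma fixMass_topTwoShuffle (s : Finset (Fin m)) :
    fixMass (topTwoShuffle (m + 2)) (s.map (Fin.castAddEmb 2)) = 1 - 2 * #s / (2 * m + 1) := by
  have hfixes (x : Option (Fin m × Bool)) :
      (∀ a ∈ s.map (Fin.castAddEmb 2), topTwoIncrement x • a = a) ↔
        x ∈ ((s ×ˢ univ).map Function.Embedding.some)ᶜ := by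
    have happly (i : Fin m) : topTwoIncrement x • Fin.castAdd 2 i = Fin.castAdd 2 i ↔
      ∀ b, x ≠ some (i, b) := formPerm_topTwoCycle_apply_castAdd_eq_iff x i
    rcases x with _ | ⟨i, b⟩ <;> simp [happly]
  have hcard : #s * 2 ≤ m * 2 + 1 := by
    have : #s ≤ m := card_finset_fin_le s
    lia
  rw [fixMass, sum_topTwoShuffle_filter]
  simp only [hfixes, filter_univ_mem, card_compl, card_map, card_product, Fintype.card_option,
    Fintype.card_prod, Fintype.card_fin, Fintype.card_bool, card_univ]
  push_cast [hcard]
  field_simp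

lemma topTwoShuffle_mem_stdSimplex :
    topTwoShuffle (m + 2) ∈ stdSimplex ℝ (alternatingGroup (Fin (m + 2))) :=
  ⟨fun π => by
    rw [topTwoShuffle_add_two]
    exact Set.indicator_nonneg (fun _ _ => by positivity) π, by
    simpa [fixMass] using fixMass_topTwoShuffle (m := m) ∅⟩

lemma pairwise_fixMass_topTwoShuffle_le_mul :
    (univ.map (Fin.castAddEmb 2 : Fin m ↪ Fin (m + 2)) : Set (Fin (m + 2))).Pairwise fun a b =>
      fixMass (topTwoShuffle (m + 2)) {a, b} ≤
        fixMass (topTwoShuffle (m + 2)) {a} * fixMass (topTwoShuffle (m + 2)) {b} := by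
  intro a ha b hb hab
  obtain ⟨i, -, rfl⟩ := mem_map.1 ha
  obtain ⟨j, -, rfl⟩ := mem_map.1 hb
  have hij : i ≠ j := fun h => hab (congrArg _ h)
  simp only [← map_singleton, ← map_insert, fixMass_topTwoShuffle, card_singleton, card_pair hij]
  have hdouble : 2 * (2 : ℝ) / (2 * m + 1) = 2 * (2 / (2 * m + 1)) := by ring
  push_cast
  rw [hdouble, mul_one]
  linarith [mul_self_nonneg (2 / (2 * (m : ℝ) + 1))]

lemma shuffleTV_add_two_le_one (m k : ℕ) : shuffleTV (m + 2) k ≤ 1 :=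
  tvDist_le_one (convPow_mem_stdSimplex topTwoShuffle_mem_stdSimplex k)
    (uniformDist_mem_stdSimplex _)

lemma one_sub_six_div_le_shuffleTV_add_two (hm : 2 ≤ m) (k : ℕ) :
    1 - 6 / (1 + m * (1 - 2 / (2 * (m : ℝ) + 1)) ^ k) ≤ shuffleTV (m + 2) k := by
  have := isMultiplyPretransitive_alternatingGroup_two (α := Fin (m + 2)) (by simpa using hm)
  have h := one_sub_six_div_le_tvDist_convPow_uniformDist topTwoShuffle_mem_stdSimplex
    (pairwise_fixMass_topTwoShuffle_le_mul (m := m)) k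
  simpa [shuffleTV, ← map_singleton, fixMass_topTwoShuffle, -Fin.coe_castAddEmb] using h

end TopTwo

section Asymptotics

lemma exp_neg_div_sub_one_le_one_sub_inv_pow {x : ℝ} (hx : 1 < x) (k : ℕ) :
    Real.exp (-(k / (x - 1))) ≤ (1 - 1 / x) ^ k := by
  have hx1 : 0 < x - 1 := sub_pos.2 hx
  have hbase : Real.exp (-(1 / (x - 1))) ≤ 1 - 1 / x :=
    calc Real.exp (-(1 / (x - 1))) = (Real.exp (1 / (x - 1)))⁻¹ := Real.exp_neg _
      _ ≤ (1 / (x - 1) + 1)⁻¹ := by gcongr; exact Real.add_one_le_exp _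
      _ = 1 - 1 / x := by field_simp; ring
  calc Real.exp (-(k / (x - 1))) = Real.exp (-(1 / (x - 1))) ^ k := by
        rw [← Real.exp_nat_mul]; ring_nf
    _ ≤ (1 - 1 / x) ^ k := by gcongr

/-- The correction `δ n` in the lower bound for the shuffle of `n` cards: `1 - 2 / n` accounts for
the last two cards, which are not counted, and the exponential for replacing
`(1 - 1 / (n - 3 / 2)) ^ k` by `exp (-k / (n - 3 / 2))`. -/
noncomputable def lowerBoundCorrection (n : ℕ) : ℝ :=
  (1 - 2 / n) * Real.exp (-(Real.log n / (n - 5 / 2))) - 1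

lemma tendsto_lowerBoundCorrection : Tendsto lowerBoundCorrection atTop (𝓝 0) := by
  have hlog : Tendsto (fun n : ℕ => Real.log n / ((n : ℝ) - 5 / 2)) atTop (𝓝 0) := by
    simpa [Function.comp_def, sub_eq_add_neg] using
      (Real.tendsto_pow_log_div_mul_add_atTop 1 (-(5 / 2)) 1 one_ne_zero).comp
        (tendsto_natCast_atTop_atTop (R := ℝ))
  have hexp : Tendsto (fun n : ℕ => Real.exp (-(Real.log n / (n - 5 / 2)))) atTop (𝓝 1) := by
    simpa [Function.comp_def] using (Real.continuous_exp.tendsto _).comp hlog.neg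
  have hfactor : Tendsto (fun n : ℕ => 1 - 2 / (n : ℝ)) atTop (𝓝 (1 - 0)) :=
    (tendsto_const_div_atTop_nhds_zero_nat 2).const_sub 1
  have hproduct := (hfactor.mul hexp).sub_const 1
  rwa [sub_zero, mul_one, sub_self] at hproduct

lemma exp_mul_one_add_lowerBoundCorrection_le {n : ℕ} (hn : 4 ≤ n) {c : ℝ} (hc : c < 0) {k : ℕ}
    (hk : (k : ℝ) = (n - 3 / 2) * (Real.log n + c)) :
    Real.exp (-c) * (1 + lowerBoundCorrection n) ≤
      (n - 2) * (1 - 1 / ((n : ℝ) - 3 / 2)) ^ k := by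
  have hn' : (4 : ℝ) ≤ n := by exact_mod_cast hn
  have hexponent : k / ((n : ℝ) - 3 / 2 - 1) ≤ Real.log n + c + Real.log n / (n - 5 / 2) := by
    have hsplit : k / ((n : ℝ) - 3 / 2 - 1) =
        Real.log n + c + (Real.log n + c) / (n - 5 / 2) := by
      rw [hk]
      have : (n : ℝ) - 5 / 2 ≠ 0 := by linarith
      have : (n : ℝ) - 3 / 2 - 1 = n - 5 / 2 := by ring
      grind
    rw [hsplit]
    gcongr <;> linarith
  calc Real.exp (-c) * (1 + lowerBoundCorrection n)
      = (n - 2) * Real.exp (-(Real.log n + c + Real.log n / (n - 5 / 2))) := by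
        rw [lowerBoundCorrection, neg_add, neg_add, Real.exp_add, Real.exp_add,
          Real.exp_neg (Real.log n), Real.exp_log (by positivity)]
        field_simp
        ring
    _ ≤ (n - 2) * Real.exp (-(k / ((n : ℝ) - 3 / 2 - 1))) := by
        gcongr
        linarith
    _ ≤ (n - 2) * (1 - 1 / ((n : ℝ) - 3 / 2)) ^ k := by
        gcongr
        · linarith
        · exact exp_neg_div_sub_one_le_one_sub_inv_pow (by linarith) k

lemma one_sub_exp_le_shuffleTV {n : ℕ} (hn : 4 ≤ n) {c : ℝ} (hc : c < 0) {k : ℕ}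
    (hk : (k : ℝ) = (n - 3 / 2) * (Real.log n + c)) :
    1 - 6 / (1 + Real.exp (-c) * (1 + lowerBoundCorrection n)) ≤ shuffleTV n k := by
  have hmean := exp_mul_one_add_lowerBoundCorrection_le hn hc hk
  have hcorrection : 0 ≤ 1 + lowerBoundCorrection n := by
    have : 2 / (n : ℝ) ≤ 1 := div_le_one_of_le₀ (by exact_mod_cast (by lia : 2 ≤ n)) (by positivity)
    rw [lowerBoundCorrection, add_sub_cancel]
    exact mul_nonneg (sub_nonneg.2 this) (Real.exp_pos _).le
  obtain ⟨m, rfl⟩ : ∃ m, n = m + 2 := ⟨n - 2, by lia⟩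
  have hstay : (1 : ℝ) - 1 / (↑(m + 2) - 3 / 2) = 1 - 2 / (2 * m + 1) := by
    push_cast
    have : (m : ℝ) + 2 - 3 / 2 = (2 * m + 1) / 2 := by ring
    rw [this, one_div_div]
  rw [hstay, Nat.cast_add, Nat.cast_two, add_sub_cancel_right] at hmean
  refine le_trans ?_ (one_sub_six_div_le_shuffleTV_add_two (by lia) k)
  gcongr

lemma one_sub_rpow_le_shuffleTV_floor {n : ℕ} (hn : 4 ≤ n) {ε : ℝ} (hε : 0 < ε) (hε1 : ε < 1)
    (hcorrection : -(1 / 2) < lowerBoundCorrection n) :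
    1 - 6 / (1 + (n : ℝ) ^ ε * (1 / 2)) ≤
      shuffleTV n ⌊(1 - ε) * ((n : ℝ) - 3 / 2) * Real.log n⌋₊ := by
  set k := ⌊(1 - ε) * ((n : ℝ) - 3 / 2) * Real.log n⌋₊
  set c := k / ((n : ℝ) - 3 / 2) - Real.log n with hcdef
  have hn' : (4 : ℝ) ≤ n := by exact_mod_cast hn
  have hspeed : 0 < (n : ℝ) - 3 / 2 := by linarith
  have hlog : 0 < Real.log n := Real.log_pos (by linarith)
  have hk : (k : ℝ) ≤ (1 - ε) * ((n : ℝ) - 3 / 2) * Real.log n :=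
    Nat.floor_le (mul_nonneg (mul_nonneg (sub_pos.2 hε1).le hspeed.le) hlog.le)
  have hc : c ≤ -(Real.log n * ε) := by
    have : k / ((n : ℝ) - 3 / 2) ≤ (1 - ε) * Real.log n := by
      rw [div_le_iff₀ hspeed]
      linarith
    linarith
  have hc0 : c < 0 := hc.trans_lt (neg_neg_of_pos (mul_pos hlog hε))
  calc 1 - 6 / (1 + (n : ℝ) ^ ε * (1 / 2))
      ≤ 1 - 6 / (1 + Real.exp (-c) * (1 + lowerBoundCorrection n)) := by
        rw [Real.rpow_def_of_pos (by linarith)]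
        gcongr <;> linarith
    _ ≤ shuffleTV n k :=
        one_sub_exp_le_shuffleTV hn hc0 <| by
          rw [hcdef, add_sub_cancel, mul_div_cancel₀ _ hspeed.ne']

lemma tendsto_shuffleTV_floor {ε : ℝ} (hε : 0 < ε) (hε1 : ε < 1) :
    Tendsto (fun n : ℕ => shuffleTV n ⌊(1 - ε) * ((n : ℝ) - 3 / 2) * Real.log n⌋₊)
      atTop (𝓝 1) := by
  have hlower : Tendsto (fun n : ℕ => 1 - 6 / (1 + (n : ℝ) ^ ε * (1 / 2))) atTop (𝓝 1) := by
    have hmean : Tendsto (fun n : ℕ => 1 + (n : ℝ) ^ ε * (1 / 2)) atTop atTop :=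
      tendsto_atTop_add_const_left _ _
        (((tendsto_rpow_atTop hε).comp tendsto_natCast_atTop_atTop).atTop_mul_const (by norm_num))
    simpa using (hmean.const_div_atTop 6).const_sub 1
  have hcorrection : ∀ᶠ n in atTop, -(1 / 2) < lowerBoundCorrection n :=
    tendsto_lowerBoundCorrection.eventually_const_lt (by norm_num)
  refine tendsto_of_tendsto_of_tendsto_of_le_of_le' hlower tendsto_const_nhds ?_ ?_
  · filter_upwards [hcorrection, eventually_ge_atTop 4] with n hcn hn
    exact one_sub_rpow_le_shuffleTV_floor hn hε hε1 hcn
  · filter_upwards [eventually_ge_atTop 2] with n hn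
    obtain ⟨m, rfl⟩ := Nat.exists_eq_add_of_le' hn
    exact shuffleTV_add_two_le_one m _

end Asymptotics

theorem mainTheorem3 :
    (∃ δ : ℕ → ℝ, Filter.Tendsto δ Filter.atTop (nhds 0) ∧
      ∃ N : ℕ, ∀ n : ℕ, N ≤ n → ∀ c : ℝ, c < 0 → ∀ k : ℕ,
        (k : ℝ) = ((n : ℝ) - 3 / 2) * (Real.log n + c) →
          1 - 6 / (1 + Real.exp (-c) * (1 + δ n)) ≤ shuffleTV n k) ∧
    (∀ ε : ℝ, 0 < ε → ε < 1 →
      Filter.Tendsto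
        (fun n : ℕ => shuffleTV n ⌊(1 - ε) * ((n : ℝ) - 3 / 2) * Real.log n⌋₊)
        Filter.atTop (nhds 1)) :=
  ⟨⟨lowerBoundCorrection, tendsto_lowerBoundCorrection, 4,
      fun _ hn _ hc _ hk => one_sub_exp_le_shuffleTV hn hc hk⟩,
    fun _ hε hε1 => tendsto_shuffleTV_floor hε hε1⟩
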